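/- Notation. $2^\omega$ is the space of infinite binary sequences; for a finite binary string $\sigma$, $\llbracket\sigma\rrbracket$ is the set of $x\in 2^\omega$ extending $\sigma$. A probability measure $\nu$ on $2^\omega$ is computable if $\nu(\llbracket\sigma\rrbracket)$ is a computable real uniformly in $\sigma$. A probability measure $\nu$ on $[0,1]$ is computable if the measures $\nu(I_1\cup\dots\cup I_k)$ of finite unions of rational open intervals (intersected with $[0,1]$) are lower semicomputable uniformly in the intervals. Let $X$ be $2^\omega$ or $[0,1]$, with the sets $\llbracket\sigma\rrbracket$, respectively the rational open intervals intersected with $[0,1]$, as basic open sets. For a probability measure $\mu$ on $X$ and an oracle $z$, a $\mu$-Martin-Löf test relative to $z$ is a sequence $(\mathcal U_i)_{i\in\mathbb N}$ of subsets of $X$ with $\mu(\mathcal U_i)\le 2^{-i}$ such that each $\mathcal U_i$ is the union of a set of basic open sets that is recursively enumerable in $z$, uniformly in $i$; a point of $X$ is $\mu$-Martin-Löf random relative to $z$ if it lies in $\bigcap_i\mathcal U_i$ for no such test. A sequence $x\in 2^\omega$ is proper if it is Martin-Löf random (without oracle) for some computable probability measure on $2^\omega$, and a number $p\in[0,1]$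 is proper if it is Martin-Löf random (without oracle) for some computable probability measure on $[0,1]$. For $p\in[0,1]$, the Bernoulli measure $\mu_p$ on $2^\omega$ is given by $\mu_p(\llbracket\sigma\rrbracket)=p^{\#_0(\sigma)}(1-p)^{\#_1(\sigma)}$, where $\#_i(\sigma)$ is the number of occurrences of $i$ in $\sigma$, and $x\in 2^\omega$ is Bernoulli $p$-random if it is $\mu_p$-Martin-Löf random relative to (the binary expansion of) $p$. Theorem. Let $x\in 2^\omega$ be proper and suppose that $x$ is Bernoulli $p$-random for some $p\in[0,1]$. Then $p$ is proper. -/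

import Mathlib

open MeasureTheory

namespace BernoulliRandom

/-! ### Effectively open sets and Martin-Löf randomness over a countable basis -/

/-- `p` is recursively enumerable relative to the oracles in `O`: it is the domain of a partial
function recursive in `O`. For `O = ∅` this is plain recursive enumerability. -/
def REPredIn {α : Type} [Primcodable α] (O : Set (ℕ →. ℕ)) (p : α → Prop) : Prop :=
  RecursiveIn O fun a => Part.assert (p a) fun _ => Part.some ()

/-- Relative to a numbered family `B` of basic open sets, `U : ℕ → Set X` is a uniformly
`Σ⁰₁` sequence of sets with oracles in `O`. -/
def UniformlySigma01 {ι X : Type} [Primcodable ι] (B : ι → Set X) (O : Set (ℕ →. ℕ))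
    (U : ℕ → Set X) : Prop :=
  ∃ W : ℕ × ι → Prop, REPredIn O W ∧ ∀ i, U i = {x | ∃ b, W (i, b) ∧ x ∈ B b}

/-- `U` is a `μ`-Martin-Löf test with oracles in `O`. -/
def IsMLTest {ι X : Type} [Primcodable ι] [MeasurableSpace X] (B : ι → Set X) (μ : Measure X)
    (O : Set (ℕ →. ℕ)) (U : ℕ → Set X) : Prop :=
  UniformlySigma01 B O U ∧ ∀ i, μ (U i) ≤ (2⁻¹ : ENNReal) ^ i

/-- `x` passes every `μ`-Martin-Löf test with oracles in `O`. -/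
def IsMLRandom {ι X : Type} [Primcodable ι] [MeasurableSpace X] (B : ι → Set X) (μ : Measure X)
    (O : Set (ℕ →. ℕ)) (x : X) : Prop :=
  ∀ U : ℕ → Set X, IsMLTest B μ O U → x ∉ ⋂ i, U i

/-! ### The Cantor space -/

/-- The basic clopen set `⟦σ⟧` of the infinite binary sequences that extend `σ`
(`false` is the symbol `0`, `true` is the symbol `1`). -/
def cyl (σ : List Bool) : Set (ℕ → Bool) :=
  {x | ∀ (i : ℕ) (h : i < σ.length), x i = σ[i]}

/-- `μ(⟦σ⟧)` is a computable real number, uniformly in `σ`: a computable function gives, for each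
`σ` and `n`, an approximation of the form `f σ n / 2 ^ n` with error at most `2⁻ⁿ`. -/
def IsComputableCantor (μ : Measure (ℕ → Bool)) : Prop :=
  ∃ f : List Bool → ℕ → ℕ, Computable₂ f ∧
    ∀ σ n, |μ.real (cyl σ) - (f σ n : ℝ) / 2 ^ n| ≤ (2⁻¹ : ℝ) ^ n

/-- A binary sequence is proper if it is Martin-Löf random for some computable probability
measure on the Cantor space. -/
def ProperSeq (x : ℕ → Bool) : Prop :=
  ∃ ν : Measure (ℕ → Bool), IsProbabilityMeasure ν ∧ IsComputableCantor ν ∧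
    IsMLRandom cyl ν ∅ x

/-! ### The unit interval -/

/-- The basic open subsets of `[0,1]`: the traces on `[0,1]` of the open intervals with rational
centre `a / (c + 1)` and rational radius `b / (c + 1)`, numbered by `(a, b, c)`. -/
def ratBall (t : ℕ × ℕ × ℕ) : Set unitInterval :=
  {x | |(x : ℝ) - (t.1 : ℝ) / (t.2.2 + 1)| < (t.2.1 : ℝ) / (t.2.2 + 1)}

/-- A (probability) measure on `[0,1]` is computable if the measures of finite unions of
rational open intervals are lower semicomputable, uniformly: the pairs of a finite list of
intervals and a rational number `m / (k + 1)` smaller than the measure of their union can be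
recursively enumerated. -/
def IsComputableInterval (ν : Measure unitInterval) : Prop :=
  REPred fun a : List (ℕ × ℕ × ℕ) × (ℕ × ℕ) =>
    (a.2.1 : ℝ) / (a.2.2 + 1) < ν.real {x | ∃ t ∈ a.1, x ∈ ratBall t}

/-- A number in `[0,1]` is proper if it is Martin-Löf random for some computable probability
measure on `[0,1]`. -/
def ProperReal (p : unitInterval) : Prop :=
  ∃ ν : Measure unitInterval, IsProbabilityMeasure ν ∧ IsComputableInterval ν ∧
    IsMLRandom ratBall ν ∅ p

/-! ### Bernoulli measures and Bernoulli randomness -/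

/-- The Bernoulli `p`-measure on the Cantor space: independent bits, each equal to `0` with
probability `p` and to `1` with probability `1 - p`. -/
noncomputable def bernoulliSeq (p : unitInterval) : Measure (ℕ → Bool) :=
  Measure.infinitePi fun _ : ℕ => ProbabilityTheory.bernoulliMeasure false true p

/-- `μ_p(⟦σ⟧) = p ^ #₀(σ) * (1 - p) ^ #₁(σ)`. -/
theorem bernoulliSeq_real_cyl (p : unitInterval) (σ : List Bool) :
    (bernoulliSeq p).real (cyl σ) =
      (p : ℝ) ^ σ.count false * (1 - (p : ℝ)) ^ σ.count true := by
  have h : cyl σ = Set.pi (Finset.range σ.length) (fun i => {b | ∀ h : i < σ.length, b = σ[i]}) := by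
    ext x; simp [cyl, Set.mem_pi]
  have key : ∀ τ : List Bool, ∏ i ∈ Finset.range τ.length,
      (ProbabilityTheory.bernoulliMeasure false true p).real {b | ∀ h : i < τ.length, b = τ[i]} =
      (p : ℝ) ^ τ.count false * (1 - (p : ℝ)) ^ τ.count true := by
    intro τ
    induction τ with
    | nil => simp
    | cons a τ ih =>
      simp only [List.length_cons]
      rw [Finset.prod_range_succ']
      simp only [List.getElem_cons_succ, Nat.add_lt_add_iff_right, ih]
      cases a <;>
      simp [ProbabilityTheory.bernoulliMeasure_def, Measure.real,  pow_succ] <;> ring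
  rw [← key, h, bernoulliSeq, Measure.real, Measure.infinitePi_pi _ (fun _ _ => MeasurableSet.of_discrete), ENNReal.toReal_prod]
  rfl

/-- The number `p` as an oracle: the function `n ↦ ⌊2ⁿ p⌋`, whose value at `n` codes the first `n`
digits of the binary expansion of `p`. -/
noncomputable def realOracle (p : unitInterval) : ℕ →. ℕ :=
  fun n => Part.some ⌊(2 : ℝ) ^ n * (p : ℝ)⌋₊

/-- `x` is Bernoulli `p`-random: it passes every `μ_p`-Martin-Löf test relative to `p`. -/
def IsBernoulliRandom (p : unitInterval) (x : ℕ → Bool) : Prop :=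
  IsMLRandom cyl (bernoulliSeq p) {realOracle p} x

end BernoulliRandom

/-! A Bernoulli `p`-random `x` has frequency of zeros `p`, so `p` should be the image of `x` under a
computable map, and the image of a random point under a computable map is random for the image
measure. The frequency is not a total computable function, so convergence is forced: `freq C` reads
the counts of zeros at the lengths `8 ^ k` and ignores each update that moves the frequency by more
than `C * 2⁻ᵏ / 8`. For every fixed `C` this is a total map on Cantor space with a known modulus of
convergence.

Some `C` recovers `p` from `x`. By Chebyshev the count at length `8 ^ k` is off by `4 ^ k` or more
with probability at most `2⁻⁽ᵏ⁺¹⁾`; these bounds are summable, so large deviations form a Martin-Löf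
test relative to `p`. Since `x` passes it, the error is at most `D * 4 ^ k` for all `k`
(`exists_abs_zeros_sub_le`), and with `C = 12 * D` no update along `x` is ignored
(`exists_freq_eq`).

If `x` is random for a computable `ν`, then `ν.map (freq C)` is computable
(`isComputableInterval_map_freq`), and tests for it pull back to tests for `ν`
(`isMLRandom_map_freq`). The constant `C` depends on `x`, but only its existence is needed. -/

namespace BernoulliRandom

open Filter Topology Finset

/-! ### Recursively enumerable predicates -/

section RE

variable {α β : Type} [Primcodable α] [Primcodable β]

theorem rePred_exists_nat {f : α → ℕ → Bool} (hf : Computable₂ f) :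
    REPred fun a => ∃ n, f a n = true := by
  have h : Partrec fun a => Nat.rfind fun n => Part.some (f a n) := Partrec.rfind hf.partrec₂
  refine h.dom_re.of_eq fun a => Nat.rfind_dom'.trans ⟨?_, ?_⟩
  · rintro ⟨n, hn, -⟩
    exact ⟨n, (Part.mem_some_iff.1 hn).symm⟩
  · rintro ⟨n, hn⟩
    exact ⟨n, Part.mem_some_iff.2 hn.symm, fun _ => trivial⟩

theorem exists_computable_of_rePred {p : α → Prop} (hp : REPred p) :
    ∃ f : α → ℕ → Bool, Computable₂ f ∧ ∀ a, p a ↔ ∃ n, f a n = true := by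
  obtain ⟨c, hc⟩ := Nat.Partrec.Code.exists_code.1 hp
  refine ⟨fun a n => (Nat.Partrec.Code.evaln n c (Encodable.encode a)).isSome, ?_, fun a => ?_⟩
  · refine (Primrec.option_isSome.comp (Nat.Partrec.Code.primrec_evaln.comp
      (Primrec.pair (Primrec.pair Primrec.snd (Primrec.const c))
        (Primrec.encode.comp Primrec.fst)))).to_comp
  · have h := congrFun hc (Encodable.encode a)
    have h' : p a ↔ (Nat.Partrec.Code.eval c (Encodable.encode a)).Dom := by
      rw [h]; simp [Encodable.encodek, Part.assert]
    rw [h', Part.dom_iff_mem]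
    simp only [Nat.Partrec.Code.evaln_complete, Option.isSome_iff_exists, Option.mem_def]
    exact exists_comm

/-- Dovetailing: a single search runs over the codes of pairs of a witness and a time bound. -/
theorem rePred_exists {p : α × β → Prop} (hp : REPred p) : REPred fun a => ∃ b, p (a, b) := by
  obtain ⟨f, hf, h⟩ := exists_computable_of_rePred hp
  have hg : Computable₂ fun (a : α) (m : ℕ) =>
      ((Encodable.decode (α := β × ℕ) m).map fun q => f (a, q.1) q.2).getD false :=
    Computable.option_getD
      (Computable.option_map (Computable.decode.comp Computable.snd)
        (hf.comp ((Computable.fst.comp Computable.fst).pair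
          (Computable.fst.comp Computable.snd)) (Computable.snd.comp Computable.snd)).to₂)
      (Computable.const false)
  refine (rePred_exists_nat hg).of_eq fun a => ⟨?_, ?_⟩
  · rintro ⟨m, hm⟩
    rcases hd : Encodable.decode (α := β × ℕ) m with _ | q
    · simp [hd] at hm
    · exact ⟨q.1, (h _).2 ⟨q.2, by simpa [hd] using hm⟩⟩
  · rintro ⟨b, hb⟩
    obtain ⟨n, hn⟩ := (h _).1 hb
    exact ⟨Encodable.encode (b, n), by simpa [Encodable.encodek] using hn⟩

theorem rePred_and {p q : α → Prop} (hp : REPred p) (hq : REPred q) :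
    REPred fun a => p a ∧ q a := by
  refine (Partrec.bind hp (hq.comp Computable.fst).to₂).of_eq fun a => ?_
  refine Part.ext fun u => ?_
  simp

theorem rePred_comp {p : β → Prop} (hp : REPred p) {g : α → β} (hg : Computable g) :
    REPred fun a => p (g a) :=
  Partrec.comp hp hg

/-- A condition that is computable from one value of the oracle is r.e. in the oracle. -/
theorem rePredIn_of_oracle_value {o : ℕ → ℕ} {g : α → ℕ} (hg : Computable g)
    {P : α × ℕ → Prop} (hP : ComputablePred P) :
    REPredIn {fun n => Part.some (o n)} fun a => P (a, o (g a)) := by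
  set O : Set (ℕ →. ℕ) := {fun n => Part.some (o n)}
  have h1 : Nat.RecursiveIn O fun n =>
      Part.bind (Encodable.decode (α := α) n) fun a => Part.some (g a) :=
    Nat.Partrec.recursiveIn hg
  have h2 : Nat.RecursiveIn O fun n => Part.some (o n) := .oracle _ rfl
  have h3 : Nat.RecursiveIn O fun n => Part.some n := Nat.Partrec.some.recursiveIn
  -- The oracle is queried once, at `g a`; an oracle-free procedure then handles the code of the
  -- pair of input and answer.
  have h4 : Partrec fun m : ℕ => Part.bind (Encodable.decode (α := α) m.unpair.1) fun a =>
      (Part.assert (P (a, m.unpair.2)) fun _ => Part.some ()).map Encodable.encode := by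
    refine Partrec.bind (Computable.ofOption
      (Computable.decode.comp (Computable.fst.comp Computable.unpair))) ?_
    refine Partrec.map ?_ (Computable.encode.comp Computable.snd).to₂
    exact Partrec.comp hP.to_re
      (Computable.snd.pair (Computable.snd.comp (Computable.unpair.comp Computable.fst)))
  have h5 := Nat.RecursiveIn.comp (Nat.Partrec.recursiveIn (O := O) (Partrec.nat_iff.1 h4))
    (h3.pair (h2.comp h1))
  refine h5.of_eq fun n => ?_
  rcases hd : Encodable.decode (α := α) n with _ | a
  · simp [Seq.seq]
  · simp only [Seq.seq, hd, Part.map_eq_map, Part.map_some, Part.bind_eq_bind, Part.coe_some,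
      Part.bind_some, Nat.unpair_pair]
    exact congrArg (fun v => (Part.assert (P (a, v)) fun _ => Part.some ()).map Encodable.encode)
      (congrArg Prod.snd (Nat.unpair_pair n (o (g a))))

end RE

/-! ### Limiting frequencies with a forced rate of convergence -/

/-- The number of zeros among the first `n` bits. -/
def zeros (y : ℕ → Bool) (n : ℕ) : ℕ := ∑ j ∈ range n, if y j = false then 1 else 0

/-- The numerator over `8 ^ k` of the `k`-th approximation to the frequency of zeros. It is updated
only if the new value is within the tolerance `C * 2⁻ᵏ / 8` of the previous one. -/
def stage (C : ℕ) (y : ℕ → Bool) : ℕ → ℕ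
  | 0 => zeros y 1
  | k + 1 =>
    if zeros y (8 ^ (k + 1)) ≤ 8 * stage C y k + C * 4 ^ k ∧
        8 * stage C y k ≤ zeros y (8 ^ (k + 1)) + C * 4 ^ k then
      zeros y (8 ^ (k + 1))
    else 8 * stage C y k

/-- The finite string `σ` followed by ones. -/
def padded (σ : List Bool) : ℕ → Bool := fun j => σ.getD j true

theorem zeros_le (y : ℕ → Bool) (n : ℕ) : zeros y n ≤ n := by
  unfold zeros
  calc _ ≤ ∑ j ∈ range n, 1 := sum_le_sum fun j _ => by split_ifs <;> simp
    _ = n := by simp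

theorem zeros_congr {y z : ℕ → Bool} {n : ℕ} (h : ∀ j < n, y j = z j) : zeros y n = zeros z n :=
  sum_congr rfl fun j hj => by rw [h j (mem_range.1 hj)]

theorem stage_le (C : ℕ) (y : ℕ → Bool) (k : ℕ) : stage C y k ≤ 8 ^ k := by
  induction k with
  | zero => simpa [stage] using zeros_le y 1
  | succ k ih =>
    rw [stage]
    split_ifs
    · exact zeros_le _ _
    · rw [pow_succ]; omega

/-- A string of length `8 ^ k` thus decides stage `k`, which reduces questions about `freq` to
finite strings. -/
theorem stage_congr (C : ℕ) {y z : ℕ → Bool} {k : ℕ} (h : ∀ j < 8 ^ k, y j = z j) :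
    stage C y k = stage C z k := by
  induction k with
  | zero => exact zeros_congr (by simpa using h)
  | succ k ih =>
    have h1 := ih fun j hj => h j (hj.trans (Nat.pow_lt_pow_right (by norm_num) k.lt_succ_self))
    rw [stage, stage, h1, zeros_congr h]

/-- A rejected update only rescales the old value, so the rate of convergence holds for every `y`,
even one without a limiting frequency. -/
theorem stage_succ_near (C : ℕ) (y : ℕ → Bool) (k : ℕ) :
    stage C y (k + 1) ≤ 8 * stage C y k + C * 4 ^ k ∧
      8 * stage C y k ≤ stage C y (k + 1) + C * 4 ^ k := by
  rw [stage]
  split_ifs with h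
  · exact h
  · exact ⟨Nat.le_add_right _ _, Nat.le_add_right _ _⟩

theorem stage_eq_zeros {C : ℕ} {y : ℕ → Bool}
    (h : ∀ k, zeros y (8 ^ (k + 1)) ≤ 8 * zeros y (8 ^ k) + C * 4 ^ k ∧
      8 * zeros y (8 ^ k) ≤ zeros y (8 ^ (k + 1)) + C * 4 ^ k) (k : ℕ) :
    stage C y k = zeros y (8 ^ k) := by
  induction k with
  | zero => simp [stage]
  | succ k ih => rw [stage, ih, if_pos (h k)]

theorem primrec_nat_pow (b : ℕ) : Primrec fun k : ℕ => b ^ k :=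
  (Primrec.nat_rec' (f := fun k : ℕ => k) (g := fun _ => 1) (h := fun _ q => q.2 * b) Primrec.id
    (Primrec.const 1) (Primrec.nat_mul.comp (Primrec.snd.comp Primrec.snd)
      (Primrec.const b)).to₂).of_eq fun k => by
    induction k with
    | zero => rfl
    | succ k ih => simp only [pow_succ]; rw [← ih]

theorem primrec_zeros_padded : Primrec₂ fun (σ : List Bool) (n : ℕ) => zeros (padded σ) n := by
  have h : Primrec₂ fun (σ : List Bool) (q : ℕ × ℕ) =>
      q.2 + if σ.getD q.1 true = false then 1 else 0 :=
    Primrec.nat_add.comp (Primrec.snd.comp Primrec.snd) (Primrec.ite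
      (Primrec.eq.comp ((Primrec.list_getD true).comp Primrec.fst (Primrec.fst.comp Primrec.snd))
        (Primrec.const false)) (Primrec.const 1) (Primrec.const 0))
  refine (Primrec.nat_rec (f := fun _ : List Bool => 0) (Primrec.const 0) h).of_eq
    fun σ n => ?_
  induction n with
  | zero => simp [zeros]
  | succ n ih => simp only [zeros, sum_range_succ] at ih ⊢; rw [ih]; rfl

theorem primrec_stage_padded (C : ℕ) :
    Primrec₂ fun (σ : List Bool) (k : ℕ) => stage C (padded σ) k := by
  have hz : Primrec₂ fun (σ : List Bool) (q : ℕ × ℕ) => zeros (padded σ) (8 ^ (q.1 + 1)) :=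
    primrec_zeros_padded.comp Primrec.fst ((primrec_nat_pow 8).comp
      (Primrec.succ.comp (Primrec.fst.comp Primrec.snd)))
  have h8 : Primrec₂ fun (_ : List Bool) (q : ℕ × ℕ) => 8 * q.2 :=
    Primrec.nat_mul.comp (Primrec.const 8) (Primrec.snd.comp Primrec.snd)
  have h4 : Primrec₂ fun (_ : List Bool) (q : ℕ × ℕ) => C * 4 ^ q.1 :=
    Primrec.nat_mul.comp (Primrec.const C) ((primrec_nat_pow 4).comp
      (Primrec.fst.comp Primrec.snd))
  have h : Primrec₂ fun (σ : List Bool) (q : ℕ × ℕ) =>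
      if zeros (padded σ) (8 ^ (q.1 + 1)) ≤ 8 * q.2 + C * 4 ^ q.1 ∧
        8 * q.2 ≤ zeros (padded σ) (8 ^ (q.1 + 1)) + C * 4 ^ q.1 then
      zeros (padded σ) (8 ^ (q.1 + 1)) else 8 * q.2 :=
    Primrec.ite ((Primrec.nat_le.comp hz (Primrec.nat_add.comp h8 h4)).and
      (Primrec.nat_le.comp h8 (Primrec.nat_add.comp hz h4))) hz h8
  refine (Primrec.nat_rec (primrec_zeros_padded.comp Primrec.id (Primrec.const 1)) h).of_eq
    fun σ n => ?_
  induction n with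
  | zero => rfl
  | succ n ih => simp only [stage] at ih ⊢; rw [ih]

/-- The `k`-th approximation to the frequency of zeros. -/
noncomputable def approx (C : ℕ) (y : ℕ → Bool) (k : ℕ) : ℝ := stage C y k / 8 ^ k

theorem dist_approx_succ_le (C : ℕ) (y : ℕ → Bool) (k : ℕ) :
    dist (approx C y k) (approx C y (k + 1)) ≤ C / 8 * (1 / 2 : ℝ) ^ k := by
  obtain ⟨h1, h2⟩ := stage_succ_near C y k
  have h1' : (stage C y (k + 1) : ℝ) ≤ 8 * stage C y k + C * 4 ^ k := mod_cast h1
  have h2' : 8 * (stage C y k : ℝ) ≤ stage C y (k + 1) + C * 4 ^ k := mod_cast h2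
  have e : C / 8 * (1 / 2 : ℝ) ^ k = (C * 4 ^ k) / (8 * 8 ^ k) := by
    have : (8 : ℝ) ^ k = 4 ^ k * 2 ^ k := by rw [← mul_pow]; norm_num
    rw [this, one_div, inv_pow]; field_simp
  have e' : approx C y k - approx C y (k + 1) =
      (8 * stage C y k - stage C y (k + 1)) / (8 * 8 ^ k) := by
    simp only [approx, pow_succ]; field_simp
  rw [Real.dist_eq, e', e, abs_div, abs_of_pos (by positivity : (0 : ℝ) < 8 * 8 ^ k)]
  gcongr
  rw [abs_le]; constructor <;> linarith

/-- The limit of the approximations. -/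
noncomputable def freqReal (C : ℕ) (y : ℕ → Bool) : ℝ := limUnder atTop (approx C y)

theorem tendsto_approx (C : ℕ) (y : ℕ → Bool) :
    Tendsto (approx C y) atTop (𝓝 (freqReal C y)) :=
  (cauchySeq_of_le_geometric _ _ (by norm_num) (dist_approx_succ_le C y)).tendsto_limUnder

theorem abs_approx_sub_freqReal_le (C : ℕ) (y : ℕ → Bool) (k : ℕ) :
    |approx C y k - freqReal C y| ≤ C / 4 * (1 / 2 : ℝ) ^ k := by
  have := dist_le_of_le_geometric_of_tendsto _ _ (by norm_num) (dist_approx_succ_le C y)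
    (tendsto_approx C y) k
  rw [Real.dist_eq] at this
  refine this.trans_eq ?_
  ring

theorem approx_mem (C : ℕ) (y : ℕ → Bool) (k : ℕ) : approx C y k ∈ Set.Icc (0 : ℝ) 1 := by
  have h : (stage C y k : ℝ) ≤ 8 ^ k := mod_cast stage_le C y k
  exact ⟨by unfold approx; positivity, div_le_one_of_le₀ h (by positivity)⟩

/-- The limit of the approximations, as a point of the unit interval. -/
noncomputable def freq (C : ℕ) (y : ℕ → Bool) : unitInterval :=
  ⟨freqReal C y, isClosed_Icc.mem_of_tendsto (tendsto_approx C y)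
    (Eventually.of_forall (approx_mem C y))⟩

theorem measurable_zeros (n : ℕ) : Measurable fun y => zeros y n :=
  Finset.measurable_sum _ fun j _ =>
    Measurable.comp (g := fun b : Bool => if b = false then 1 else 0) (measurable_of_finite _)
      (measurable_pi_apply j)

theorem measurable_stage (C k : ℕ) : Measurable fun y => stage C y k := by
  induction k with
  | zero => exact measurable_zeros 1
  | succ k ih =>
    have hz := measurable_zeros (8 ^ (k + 1))
    simp only [stage]
    exact Measurable.ite ((measurableSet_le hz ((ih.const_mul 8).add_const _)).inter
      (measurableSet_le (ih.const_mul 8) (hz.add_const _))) hz (ih.const_mul 8)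

theorem measurable_freq (C : ℕ) : Measurable (freq C) := by
  refine Measurable.subtype_mk (measurable_of_tendsto_metrizable (f := fun k y => approx C y k)
    (fun k => ?_) (tendsto_pi_nhds.2 fun y => tendsto_approx C y))
  exact (measurable_from_top.comp (measurable_stage C k)).div_const _

/-! ### Finite certificates for membership in a ball -/

/-- The `k`-th approximation, with its error bound, witnesses that the limit lies in the ball. -/
def Inside (C : ℕ) (y : ℕ → Bool) (t : ℕ × ℕ × ℕ) (k : ℕ) : Prop :=
  stage C y k * (t.2.2 + 1) + C * 4 ^ k * (t.2.2 + 1) < (t.1 + t.2.1) * 8 ^ k ∧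
    t.1 * 8 ^ k + C * 4 ^ k * (t.2.2 + 1) < t.2.1 * 8 ^ k + stage C y k * (t.2.2 + 1)

theorem inside_iff {C : ℕ} {y : ℕ → Bool} {t : ℕ × ℕ × ℕ} {k : ℕ} :
    Inside C y t k ↔ |approx C y k - (t.1 : ℝ) / (t.2.2 + 1)| + C * (1 / 2 : ℝ) ^ k <
      (t.2.1 : ℝ) / (t.2.2 + 1) := by
  obtain ⟨a, b, c⟩ := t
  have e : (C : ℝ) * (1 / 2 : ℝ) ^ k = C * 4 ^ k / 8 ^ k := by
    have : (8 : ℝ) ^ k = 4 ^ k * 2 ^ k := by rw [← mul_pow]; norm_num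
    rw [this, one_div, inv_pow]; field_simp
  have hc : (0 : ℝ) < c + 1 := by positivity
  have h8 : (0 : ℝ) < 8 ^ k := by positivity
  rw [← lt_sub_iff_add_lt, abs_lt, e, approx, Inside, ← @Nat.cast_lt ℝ, ← @Nat.cast_lt ℝ, and_comm]
  push_cast
  refine and_congr ?_ ?_
  · rw [← sub_pos, ← sub_pos (b := -_)]
    have : (stage C y k : ℝ) / 8 ^ k - a / (c + 1) - -(b / (c + 1) - C * 4 ^ k / 8 ^ k) =
      (b * 8 ^ k + stage C y k * (c + 1) - (a * 8 ^ k + C * 4 ^ k * (c + 1))) /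
        (8 ^ k * (c + 1)) := by field_simp; ring
    rw [this, div_pos_iff_of_pos_right (by positivity)]
  · rw [← sub_pos, ← sub_pos (b := _ - _)]
    have : (b / (c + 1) - C * 4 ^ k / 8 ^ k - ((stage C y k : ℝ) / 8 ^ k - a / (c + 1)) : ℝ) =
      ((a + b) * 8 ^ k - (stage C y k * (c + 1) + C * 4 ^ k * (c + 1))) /
        (8 ^ k * (c + 1)) := by field_simp; ring
    rw [this, div_pos_iff_of_pos_right (by positivity)]

/-- The allowance `C * 2⁻ᵏ` drops by half of itself while the approximation moves by at most an
eighth of it. Certified events therefore increase with `k`, as continuity of measure from below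
requires. -/
theorem Inside.succ {C : ℕ} {y : ℕ → Bool} {t : ℕ × ℕ × ℕ} {k : ℕ} (h : Inside C y t k) :
    Inside C y t (k + 1) := by
  rw [inside_iff] at h ⊢
  have h1 := dist_approx_succ_le C y k
  rw [dist_comm, Real.dist_eq] at h1
  have h2 := abs_sub_le (approx C y (k + 1)) (approx C y k) ((t.1 : ℝ) / (t.2.2 + 1))
  have h3 : (0 : ℝ) ≤ C * (1 / 2 : ℝ) ^ k := by positivity
  have h4 : C / 8 * (1 / 2 : ℝ) ^ k = C * (1 / 2 : ℝ) ^ k / 8 := by ring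
  have h5 : C * (1 / 2 : ℝ) ^ (k + 1) = C * (1 / 2 : ℝ) ^ k / 2 := by ring
  rw [h5]; linarith

/-- Balls are open, so a point inside has a margin that the vanishing allowance eventually
undercuts. Conversely the allowance dominates the true error `C / 4 * 2⁻ᵏ`. -/
theorem freq_mem_ratBall_iff {C : ℕ} {y : ℕ → Bool} {t : ℕ × ℕ × ℕ} :
    freq C y ∈ ratBall t ↔ ∃ k, Inside C y t k := by
  simp only [inside_iff]
  change |freqReal C y - (t.1 : ℝ) / (t.2.2 + 1)| < (t.2.1 : ℝ) / (t.2.2 + 1) ↔ _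
  constructor
  · intro h
    have h1 : Tendsto (fun k => |approx C y k - (t.1 : ℝ) / (t.2.2 + 1)| + C * (1 / 2 : ℝ) ^ k)
        atTop (𝓝 (|freqReal C y - (t.1 : ℝ) / (t.2.2 + 1)| + C * 0)) :=
      ((tendsto_approx C y).sub_const _).abs.add
        ((tendsto_pow_atTop_nhds_zero_of_lt_one (by norm_num) (by norm_num)).const_mul _)
    rw [mul_zero, add_zero] at h1
    exact (h1.eventually_lt_const h).exists
  · rintro ⟨k, hk⟩
    have h1 := abs_approx_sub_freqReal_le C y k
    rw [abs_sub_comm] at h1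
    have h2 := abs_sub_le (freqReal C y) (approx C y k) ((t.1 : ℝ) / (t.2.2 + 1))
    have h3 : (0 : ℝ) ≤ C * (1 / 2 : ℝ) ^ k := by positivity
    have h4 : C / 4 * (1 / 2 : ℝ) ^ k = C * (1 / 2 : ℝ) ^ k / 4 := by ring
    linarith

theorem primrecPred_inside (C : ℕ) :
    PrimrecPred fun q : List Bool × (ℕ × ℕ × ℕ) × ℕ => Inside C (padded q.1) q.2.1 q.2.2 := by
  have hk : Primrec fun q : List Bool × (ℕ × ℕ × ℕ) × ℕ => q.2.2 := Primrec.snd.comp Primrec.snd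
  have ha : Primrec fun q : List Bool × (ℕ × ℕ × ℕ) × ℕ => q.2.1.1 :=
    Primrec.fst.comp (Primrec.fst.comp Primrec.snd)
  have hb : Primrec fun q : List Bool × (ℕ × ℕ × ℕ) × ℕ => q.2.1.2.1 :=
    Primrec.fst.comp (Primrec.snd.comp (Primrec.fst.comp Primrec.snd))
  have hc : Primrec fun q : List Bool × (ℕ × ℕ × ℕ) × ℕ => q.2.1.2.2 + 1 :=
    Primrec.succ.comp (Primrec.snd.comp (Primrec.snd.comp (Primrec.fst.comp Primrec.snd)))
  have h8 := (primrec_nat_pow 8).comp hk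
  have hs := Primrec.nat_mul.comp ((primrec_stage_padded C).comp Primrec.fst hk) hc
  have h4 := Primrec.nat_mul.comp
    (Primrec.nat_mul.comp (Primrec.const C) ((primrec_nat_pow 4).comp hk)) hc
  exact (Primrec.nat_lt.comp (Primrec.nat_add.comp hs h4)
      (Primrec.nat_mul.comp (Primrec.nat_add.comp ha hb) h8)).and
    (Primrec.nat_lt.comp (Primrec.nat_add.comp (Primrec.nat_mul.comp ha h8) h4)
      (Primrec.nat_add.comp (Primrec.nat_mul.comp hb h8) hs))

/-! ### The frequency of zeros in a Bernoulli random sequence -/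

instance (p : unitInterval) : IsProbabilityMeasure (bernoulliSeq p) := by
  unfold bernoulliSeq; infer_instance

/-- The indicator of the digit `0`. -/
def zeroInd (b : Bool) : ℝ := if b = false then 1 else 0

theorem zeroInd_mem (b : Bool) : zeroInd b ∈ Set.Icc (0 : ℝ) 1 := by
  unfold zeroInd; split_ifs <;> simp

theorem zeros_eq_sum_zeroInd (y : ℕ → Bool) (n : ℕ) :
    (zeros y n : ℝ) = ∑ j ∈ range n, zeroInd (y j) := by
  simp [zeros, zeroInd]

theorem measurable_zeroInd_eval (j : ℕ) : Measurable fun y : ℕ → Bool => zeroInd (y j) :=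
  (measurable_of_finite zeroInd).comp (measurable_pi_apply j)

theorem memLp_zeroInd_eval (p : unitInterval) (j : ℕ) :
    MemLp (fun y : ℕ → Bool => zeroInd (y j)) 2 (bernoulliSeq p) :=
  memLp_of_bounded (a := 0) (b := 1)
    (Eventually.of_forall fun y : ℕ → Bool => zeroInd_mem (y j))
    (measurable_zeroInd_eval j).aestronglyMeasurable 2

theorem integral_zeroInd_eval (p : unitInterval) (j : ℕ) :
    ∫ y, zeroInd (y j) ∂bernoulliSeq p = p := by
  have h := integral_map (μ := bernoulliSeq p) (measurable_pi_apply j).aemeasurable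
    (f := zeroInd) (measurable_of_finite zeroInd).aestronglyMeasurable
  rw [← h, bernoulliSeq, Measure.infinitePi_map_eval,
    ProbabilityTheory.integral_bernoulliMeasure]
  simp [zeroInd]

theorem integral_zeros (p : unitInterval) (n : ℕ) :
    ∫ y, (zeros y n : ℝ) ∂bernoulliSeq p = n * p := by
  simp_rw [zeros_eq_sum_zeroInd]
  rw [integral_finsetSum _ fun j _ => (memLp_zeroInd_eval p j).integrable (by norm_num)]
  simp [integral_zeroInd_eval]

theorem memLp_zeros (p : unitInterval) (n : ℕ) :
    MemLp (fun y => (zeros y n : ℝ)) 2 (bernoulliSeq p) := by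
  simp_rw [zeros_eq_sum_zeroInd]
  exact memLp_finsetSum _ fun j _ => memLp_zeroInd_eval p j

theorem variance_zeros_le (p : unitInterval) (n : ℕ) :
    ProbabilityTheory.variance (fun y => (zeros y n : ℝ)) (bernoulliSeq p) ≤ n / 4 := by
  have hi : ProbabilityTheory.iIndepFun (fun j (y : ℕ → Bool) => zeroInd (y j))
      (bernoulliSeq p) :=
    ProbabilityTheory.iIndepFun_infinitePi (X := fun _ => zeroInd)
      fun _ => measurable_of_finite zeroInd
  have hs : (fun y : ℕ → Bool => (zeros y n : ℝ)) =
      ∑ j ∈ range n, fun y : ℕ → Bool => zeroInd (y j) := by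
    ext y; simp [zeros_eq_sum_zeroInd]
  rw [hs, ProbabilityTheory.IndepFun.variance_sum (fun j _ => memLp_zeroInd_eval p j)
    fun i _ j _ hij => hi.indepFun hij]
  calc _ ≤ ∑ j ∈ range n, ((1 - 0) / 2 : ℝ) ^ 2 := sum_le_sum fun j _ =>
        ProbabilityTheory.variance_le_sq_of_bounded
          (Eventually.of_forall fun y : ℕ → Bool => zeroInd_mem (y j))
          (measurable_zeroInd_eval j).aemeasurable
    _ = n / 4 := by rw [sum_const, card_range, nsmul_eq_mul]; ring

/-- Chebyshev gives `(8 ^ k / 4) / 16 ^ k = 2⁻ᵏ / 4`. The window `4 ^ k` is wide enough for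
summability, yet only `2⁻ᵏ` relative to the length. -/
theorem bernoulliSeq_deviation_le (p : unitInterval) (k : ℕ) :
    bernoulliSeq p {y | (4 : ℝ) ^ k ≤ |(zeros y (8 ^ k) : ℝ) - 8 ^ k * p|} ≤
      (2⁻¹ : ENNReal) ^ (k + 1) := by
  have h := ProbabilityTheory.meas_ge_le_variance_div_sq (memLp_zeros p (8 ^ k))
    (c := (4 : ℝ) ^ k) (by positivity)
  rw [integral_zeros] at h
  push_cast at h
  refine h.trans ?_
  have e : (2⁻¹ : ENNReal) ^ (k + 1) = ENNReal.ofReal ((1 / 2 : ℝ) ^ (k + 1)) := by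
    rw [ENNReal.ofReal_pow (by norm_num), one_div, ENNReal.ofReal_inv_of_pos (by norm_num)]
    norm_num
  rw [e]
  refine ENNReal.ofReal_le_ofReal ?_
  have hv := variance_zeros_le p (8 ^ k)
  push_cast at hv
  rw [div_le_iff₀ (by positivity)]
  refine hv.trans ?_
  have e2 : ((4 : ℝ) ^ k) ^ 2 = 8 ^ k * 2 ^ k := by
    rw [← pow_mul, mul_comm k, pow_mul, ← mul_pow]; norm_num
  have e3 : (1 / 2 : ℝ) ^ (k + 1) * (8 ^ k * 2 ^ k) = 8 ^ k / 2 := by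
    rw [pow_succ, one_div, inv_pow]; field_simp
  rw [e2, e3]
  have : (0 : ℝ) < 8 ^ k := by positivity
  linarith

/-! ### The deviation test -/

theorem tsum_inv_two_pow_tail (i : ℕ) : ∑' k, (2⁻¹ : ENNReal) ^ (i + k + 1) = 2⁻¹ ^ i := by
  simp_rw [add_assoc, pow_add (2⁻¹ : ENNReal) i, ENNReal.tsum_mul_left]
  rw [ENNReal.tsum_geometric_add_one, ENNReal.one_sub_inv_two, inv_inv,
    ENNReal.inv_mul_cancel (by norm_num) (by norm_num), mul_one]

/-- The exponent `k` such that the length of `σ` is `8 ^ k`, if there is one. -/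
def level (σ : List Bool) : ℕ := Nat.findGreatest (fun k => σ.length = 8 ^ k) σ.length

theorem level_eq {σ : List Bool} {k : ℕ} (h : σ.length = 8 ^ k) : level σ = k := by
  have h1 : σ.length = 8 ^ level σ :=
    Nat.findGreatest_spec (P := fun k => σ.length = 8 ^ k) (m := k)
      (by rw [h]; exact (Nat.lt_pow_self (by norm_num)).le) h
  exact Nat.pow_right_injective (by norm_num : 2 ≤ 8) (h1.symm.trans h)

theorem primrec_level : Primrec level :=
  Primrec.nat_findGreatest Primrec.list_length
    (Primrec.eq.comp (Primrec.list_length.comp Primrec.fst)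
      ((primrec_nat_pow 8).comp Primrec.snd))

theorem padded_eq_of_mem_cyl {σ : List Bool} {y : ℕ → Bool} (h : y ∈ cyl σ) {j : ℕ}
    (hj : j < σ.length) : padded σ j = y j := by
  rw [h j hj, padded, List.getD_eq_getElem _ _ hj]

/-- `σ` shows that the frequency of zeros is far from `v / 2 ^ k` after `8 ^ k` bits, for some
`k ≥ i`. -/
def Deviates (q : (ℕ × List Bool) × ℕ) : Prop :=
  q.1.1 ≤ level q.1.2 ∧ 8 ^ level q.1.2 ≤ q.1.2.length ∧
    (q.2 * 4 ^ level q.1.2 + 2 * 4 ^ level q.1.2 < zeros (padded q.1.2) (8 ^ level q.1.2) ∨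
      zeros (padded q.1.2) (8 ^ level q.1.2) + 2 * 4 ^ level q.1.2 < q.2 * 4 ^ level q.1.2)

theorem primrecPred_deviates : PrimrecPred Deviates := by
  have hσ : Primrec fun q : (ℕ × List Bool) × ℕ => q.1.2 := Primrec.snd.comp Primrec.fst
  have hk : Primrec fun q : (ℕ × List Bool) × ℕ => level q.1.2 := primrec_level.comp hσ
  have h8 := (primrec_nat_pow 8).comp hk
  have h4 := (primrec_nat_pow 4).comp hk
  have hz := primrec_zeros_padded.comp hσ h8
  have hv := Primrec.nat_mul.comp (Primrec.snd (α := ℕ × List Bool) (β := ℕ)) h4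
  have h2 := Primrec.nat_mul.comp (Primrec.const 2) h4
  exact (Primrec.nat_le.comp (Primrec.fst.comp Primrec.fst) hk).and
    ((Primrec.nat_le.comp h8 (Primrec.list_length.comp hσ)).and
      ((Primrec.nat_lt.comp (Primrec.nat_add.comp hv h2) hz).or
        (Primrec.nat_lt.comp (Primrec.nat_add.comp hz h2) hv)))

/-- Since `8 ^ k * p = 4 ^ k * (2 ^ k * p)`, the single oracle value at `k` gives the expected count
to within `4 ^ k`. -/
theorem floor_mul_four_pow (p : unitInterval) (k : ℕ) :
    (⌊(2 : ℝ) ^ k * p⌋₊ : ℝ) * 4 ^ k ≤ 8 ^ k * p ∧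
      8 ^ k * (p : ℝ) ≤ ⌊(2 : ℝ) ^ k * p⌋₊ * 4 ^ k + 4 ^ k := by
  have h1 := Nat.floor_le (mul_nonneg (pow_nonneg zero_le_two k) p.2.1 : 0 ≤ (2 : ℝ) ^ k * p)
  have h2 := (Nat.lt_floor_add_one ((2 : ℝ) ^ k * p)).le
  have e : (8 : ℝ) ^ k * p = 2 ^ k * p * 4 ^ k := by
    rw [mul_right_comm, ← mul_pow]; norm_num
  have h4 : (0 : ℝ) ≤ 4 ^ k := by positivity
  rw [e]
  exact ⟨mul_le_mul_of_nonneg_right h1 h4,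
    (mul_le_mul_of_nonneg_right h2 h4).trans_eq (by ring)⟩

/-- The open sets of sequences whose frequency of zeros is far from `p` at some late stage. -/
def deviationTest (p : unitInterval) (i : ℕ) : Set (ℕ → Bool) :=
  {y | ∃ σ, Deviates ((i, σ), ⌊(2 : ℝ) ^ level σ * (p : ℝ)⌋₊) ∧ y ∈ cyl σ}

theorem isMLTest_deviationTest (p : unitInterval) :
    IsMLTest cyl (bernoulliSeq p) {realOracle p} (deviationTest p) := by
  refine ⟨⟨fun q => Deviates (q, ⌊(2 : ℝ) ^ level q.2 * (p : ℝ)⌋₊),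
    rePredIn_of_oracle_value (o := fun n => ⌊(2 : ℝ) ^ n * (p : ℝ)⌋₊)
      (primrec_level.comp Primrec.snd).to_comp primrecPred_deviates.computablePred,
    fun i => rfl⟩, fun i => ?_⟩
  have hsub : deviationTest p i ⊆
      ⋃ k, {y | (4 : ℝ) ^ (i + k) ≤ |(zeros y (8 ^ (i + k)) : ℝ) - 8 ^ (i + k) * p|} := by
    rintro y ⟨σ, ⟨hi, hl, hd⟩, hy⟩
    obtain ⟨k, hk⟩ := Nat.exists_eq_add_of_le hi
    dsimp only at hi hl hd hk
    refine Set.mem_iUnion.2 ⟨k, ?_⟩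
    rw [Set.mem_ofPred_eq, ← hk]
    -- The length condition `hl` covers the default `level σ = 0` of strings whose length is not a
    -- power of 8: they still fix `8 ^ 0` bits, and the empty string is excluded.
    rw [zeros_congr fun j hj => padded_eq_of_mem_cyl hy (hj.trans_le hl)] at hd
    obtain ⟨h1, h2⟩ := floor_mul_four_pow p (level σ)
    -- Of the tolerance `2 * 4 ^ k`, rounding `p` uses up at most `4 ^ k`, so a true deviation of at
    -- least `4 ^ k` remains.
    have h4 : (0 : ℝ) < 4 ^ level σ := by positivity
    rw [le_abs]
    rcases hd with hd | hd
    · left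
      have : (⌊(2 : ℝ) ^ level σ * (p : ℝ)⌋₊ : ℝ) * 4 ^ level σ + 2 * 4 ^ level σ <
        zeros y (8 ^ level σ) := mod_cast hd
      linarith
    · right
      have : (zeros y (8 ^ level σ) : ℝ) + 2 * 4 ^ level σ <
        (⌊(2 : ℝ) ^ level σ * (p : ℝ)⌋₊ : ℝ) * 4 ^ level σ := mod_cast hd
      linarith
  calc bernoulliSeq p (deviationTest p i) ≤ _ := measure_mono hsub
    _ ≤ _ := measure_iUnion_le _
    _ ≤ ∑' k, (2⁻¹ : ENNReal) ^ (i + k + 1) :=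
      ENNReal.tsum_le_tsum fun k => bernoulliSeq_deviation_le p (i + k)
    _ = _ := tsum_inv_two_pow_tail i

theorem exists_abs_zeros_sub_le {p : unitInterval} {x : ℕ → Bool} (hp : IsBernoulliRandom p x) :
    ∃ D : ℕ, ∀ k, |(zeros x (8 ^ k) : ℝ) - 8 ^ k * p| ≤ (D : ℝ) * 4 ^ k := by
  have h := hp _ (isMLTest_deviationTest p)
  rw [Set.mem_iInter, not_forall] at h
  obtain ⟨i, hi⟩ := h
  -- For `k ≥ i` the test and the rounding of `p` cost `2 + 1`; for `k < i` the trivial bound `8 ^ k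
  -- ≤ 2 ^ i * 4 ^ k` suffices.
  refine ⟨2 ^ i + 3, fun k => ?_⟩
  push_cast
  have h4 : (0 : ℝ) < 4 ^ k := by positivity
  rcases le_or_gt i k with hik | hki
  · set σ : List Bool := List.ofFn fun j : Fin (8 ^ k) => x j
    have hlen : σ.length = 8 ^ k := by simp [σ]
    have hlev := level_eq hlen
    have hmem : x ∈ cyl σ := fun j hj => by simp [σ]
    have hnd : ¬ Deviates ((i, σ), ⌊(2 : ℝ) ^ level σ * (p : ℝ)⌋₊) := fun hd => hi ⟨σ, hd, hmem⟩
    simp only [Deviates, hlev, hik, hlen, le_refl, true_and, not_or, not_lt] at hnd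
    rw [zeros_congr fun j hj => padded_eq_of_mem_cyl hmem (hlen ▸ hj)] at hnd
    obtain ⟨h1, h2⟩ := floor_mul_four_pow p k
    have h3 : (zeros x (8 ^ k) : ℝ) ≤ ⌊(2 : ℝ) ^ k * (p : ℝ)⌋₊ * 4 ^ k + 2 * 4 ^ k :=
      mod_cast hnd.1
    have h5 : (⌊(2 : ℝ) ^ k * (p : ℝ)⌋₊ : ℝ) * 4 ^ k ≤ zeros x (8 ^ k) + 2 * 4 ^ k :=
      mod_cast hnd.2
    have h6 : (0 : ℝ) ≤ 2 ^ i * 4 ^ k := by positivity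
    rw [abs_le, add_mul]
    constructor <;> linarith
  · have h1 : (zeros x (8 ^ k) : ℝ) ≤ 8 ^ k := mod_cast zeros_le x (8 ^ k)
    have h2 : (0 : ℝ) ≤ zeros x (8 ^ k) := Nat.cast_nonneg _
    have h8 : (0 : ℝ) < 8 ^ k := by positivity
    have h3 : (8 : ℝ) ^ k * p ≤ 8 ^ k := mul_le_of_le_one_right h8.le p.2.2
    have h5 : (0 : ℝ) ≤ 8 ^ k * p := mul_nonneg h8.le p.2.1
    have h6 : (8 : ℝ) ^ k ≤ 2 ^ i * 4 ^ k := by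
      have : (8 : ℝ) ^ k = 2 ^ k * 4 ^ k := by rw [← mul_pow]; norm_num
      rw [this]
      gcongr
      norm_num
    rw [abs_le, add_mul]
    constructor <;> linarith

theorem exists_freq_eq {p : unitInterval} {x : ℕ → Bool} (hp : IsBernoulliRandom p x) :
    ∃ C, freq C x = p := by
  obtain ⟨D, hD⟩ := exists_abs_zeros_sub_le hp
  -- The errors at stages `k + 1` and `k` add up to `D * 4 ^ (k + 1) + 8 * D * 4 ^ k = 12 * D * 4 ^
  -- k`.
  have hz : ∀ k, zeros x (8 ^ (k + 1)) ≤ 8 * zeros x (8 ^ k) + 12 * D * 4 ^ k ∧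
      8 * zeros x (8 ^ k) ≤ zeros x (8 ^ (k + 1)) + 12 * D * 4 ^ k := by
    intro k
    have h1 := abs_le.1 (hD k)
    have h2 := abs_le.1 (hD (k + 1))
    rw [pow_succ (4 : ℝ), pow_succ (8 : ℝ)] at h2
    constructor
    · rw [← @Nat.cast_le ℝ]; push_cast; linarith
    · rw [← @Nat.cast_le ℝ]; push_cast; linarith
  refine ⟨12 * D, Subtype.ext ?_⟩
  refine tendsto_nhds_unique (tendsto_approx _ _) ?_
  rw [tendsto_iff_dist_tendsto_zero]
  have h0 : Tendsto (fun k : ℕ => (D : ℝ) * (1 / 2) ^ k) atTop (𝓝 0) := by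
    simpa using (tendsto_pow_atTop_nhds_zero_of_lt_one (by norm_num : (0 : ℝ) ≤ 1 / 2)
      (by norm_num)).const_mul (D : ℝ)
  refine squeeze_zero (fun _ => dist_nonneg) (fun k => ?_) h0
  have h8 : (0 : ℝ) < 8 ^ k := by positivity
  have e : approx (12 * D) x k - p = (zeros x (8 ^ k) - 8 ^ k * p) / 8 ^ k := by
    rw [approx, stage_eq_zeros hz]; field_simp
  have e2 : (D : ℝ) * (1 / 2) ^ k = D * 4 ^ k / 8 ^ k := by
    have : (8 : ℝ) ^ k = 4 ^ k * 2 ^ k := by rw [← mul_pow]; norm_num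
    rw [this, one_div, inv_pow]; field_simp
  rw [Real.dist_eq, e, e2, abs_div, abs_of_pos h8]
  exact div_le_div_of_nonneg_right (hD k) h8.le

/-! ### The image of a computable measure under the frequency map -/

theorem measurableSet_cyl (σ : List Bool) : MeasurableSet (cyl σ) := by
  have : cyl σ = ⋂ (i : ℕ) (h : i < σ.length), {y | y i = σ[i]} := by ext; simp [cyl]
  rw [this]
  exact .iInter fun i => .iInter fun h => measurableSet_eq_fun (measurable_pi_apply i) (by fun_prop)

theorem mem_cyl_ofFn (y : ℕ → Bool) (n : ℕ) : y ∈ cyl (List.ofFn fun j : Fin n => y j) :=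
  fun j hj => by simp

theorem eq_of_mem_cyl {σ τ : List Bool} {y : ℕ → Bool} (h : σ.length = τ.length)
    (hσ : y ∈ cyl σ) (hτ : y ∈ cyl τ) : σ = τ :=
  List.ext_getElem h fun i h1 h2 => (hσ i h1).symm.trans (hτ i h2)

theorem isOpen_ratBall (t : ℕ × ℕ × ℕ) : IsOpen (ratBall t) :=
  isOpen_lt (by fun_prop) continuous_const

theorem inside_padded_iff {C : ℕ} {σ : List Bool} {y : ℕ → Bool} {t : ℕ × ℕ × ℕ} {k : ℕ}
    (hl : σ.length = 8 ^ k) (hy : y ∈ cyl σ) : Inside C (padded σ) t k ↔ Inside C y t k := by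
  unfold Inside
  rw [stage_congr C fun j hj => padded_eq_of_mem_cyl hy (hl ▸ hj)]

/-- The preimage of a test is a test: a cylinder is enumerated once its string certifies membership
in an enumerated ball, and the image measure keeps the bounds. -/
theorem isMLRandom_map_freq {ν : Measure (ℕ → Bool)} {x : ℕ → Bool} (hx : IsMLRandom cyl ν ∅ x)
    (C : ℕ) : IsMLRandom ratBall (ν.map (freq C)) ∅ (freq C x) := by
  rintro V ⟨⟨W, hW, hV⟩, hμ⟩ hmem
  have hW' : REPred W := recursiveIn_empty_iff.1 hW
  let Q : (ℕ × List Bool) × ((ℕ × ℕ × ℕ) × ℕ) → Prop := fun q =>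
    W (q.1.1, q.2.1) ∧ (q.1.2.length = 8 ^ q.2.2 ∧ Inside C (padded q.1.2) q.2.1 q.2.2)
  have hQ : REPred Q := by
    refine rePred_and (rePred_comp hW' (g := fun q : (ℕ × List Bool) × ((ℕ × ℕ × ℕ) × ℕ) =>
      (q.1.1, q.2.1)) ?_) ?_
    · exact (Computable.fst.comp Computable.fst).pair (Computable.fst.comp Computable.snd)
    · refine PrimrecPred.computablePred ?_ |>.to_re
      refine PrimrecPred.and ?_ ?_
      · exact Primrec.eq.comp (Primrec.list_length.comp (Primrec.snd.comp Primrec.fst))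
          ((primrec_nat_pow 8).comp (Primrec.snd.comp Primrec.snd))
      · exact (primrecPred_inside C).comp ((Primrec.snd.comp Primrec.fst).pair Primrec.snd)
  have hpre : ∀ i, freq C ⁻¹' V i = {y | ∃ σ, (∃ s, Q ((i, σ), s)) ∧ y ∈ cyl σ} := by
    intro i
    ext y
    rw [hV]
    constructor
    · rintro ⟨t, ht, hy⟩
      obtain ⟨k, hk⟩ := freq_mem_ratBall_iff.1 hy
      have hl : (List.ofFn fun j : Fin (8 ^ k) => y j).length = 8 ^ k := by simp
      exact ⟨_, ⟨(t, k), ht, hl, (inside_padded_iff hl (mem_cyl_ofFn y _)).2 hk⟩,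
        mem_cyl_ofFn y _⟩
    · rintro ⟨σ, ⟨⟨t, k⟩, ht, hl, hk⟩, hy⟩
      exact ⟨t, ht, freq_mem_ratBall_iff.2 ⟨k, (inside_padded_iff hl hy).1 hk⟩⟩
  refine hx (fun i => freq C ⁻¹' V i) ⟨⟨fun q => ∃ s, Q (q, s),
    recursiveIn_empty_iff.2 (rePred_exists hQ), hpre⟩, fun i => ?_⟩ ?_
  · have hVm : MeasurableSet (V i) := by
      have : V i = ⋃ (b) (_ : W (i, b)), ratBall b := by rw [hV]; ext; simp
      rw [this]
      exact (isOpen_biUnion fun b _ => isOpen_ratBall b).measurableSet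
    rw [← Measure.map_apply (measurable_freq C) hVm]
    exact hμ i
  · simpa using hmem

/-! ### Lower approximation of the image measure -/

/-- `σ` has length `8 ^ k` and witnesses that the limit lies in one of the balls of `L`. -/
def Certifies (C : ℕ) (L : List (ℕ × ℕ × ℕ)) (k : ℕ) (σ : List Bool) : Prop :=
  σ.length = 8 ^ k ∧ ∃ t ∈ L, Inside C (padded σ) t k

theorem primrecPred_certifies (C : ℕ) :
    PrimrecPred fun q : (List (ℕ × ℕ × ℕ) × ℕ) × List Bool => Certifies C q.1.1 q.1.2 q.2 := by
  refine PrimrecPred.and ?_ ?_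
  · exact Primrec.eq.comp (Primrec.list_length.comp Primrec.snd)
      ((primrec_nat_pow 8).comp (Primrec.snd.comp Primrec.fst))
  · have h : PrimrecRel fun (t : ℕ × ℕ × ℕ) (b : List Bool × ℕ) => Inside C (padded b.1) t b.2 :=
      (primrecPred_inside C).comp ((Primrec.fst.comp Primrec.snd).pair
        (Primrec.fst.pair (Primrec.snd.comp Primrec.snd)))
    exact h.exists_mem_list.comp (Primrec.fst.comp Primrec.fst)
      (Primrec.snd.pair (Primrec.snd.comp Primrec.fst))

open Classical in
/-- The finite set of certifying strings. -/
noncomputable def certificates (C : ℕ) (L : List (ℕ × ℕ × ℕ)) (k : ℕ) : Finset (List Bool) :=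
  (List.finite_length_eq Bool (8 ^ k)).toFinset.filter (Certifies C L k)

theorem mem_certificates {C : ℕ} {L : List (ℕ × ℕ × ℕ)} {k : ℕ} {σ : List Bool} :
    σ ∈ certificates C L k ↔ Certifies C L k σ := by
  simp only [certificates, mem_filter, Set.Finite.mem_toFinset, Set.mem_ofPred_eq,
    and_iff_right_iff_imp]
  exact fun h => h.1

/-- The event depends on the first `8 ^ k` bits only, so it is a disjoint union of cylinders of that
length. -/
theorem measureReal_exists_inside (ν : Measure (ℕ → Bool)) [IsProbabilityMeasure ν] (C : ℕ)
    (L : List (ℕ × ℕ × ℕ)) (k : ℕ) :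
    ν.real {y | ∃ t ∈ L, Inside C y t k} = ∑ σ ∈ certificates C L k, ν.real (cyl σ) := by
  rw [← measureReal_biUnion_finset]
  · congr 1
    ext y
    simp only [Set.mem_iUnion, mem_certificates, exists_prop]
    constructor
    · rintro ⟨t, ht, hy⟩
      have hl : (List.ofFn fun j : Fin (8 ^ k) => y j).length = 8 ^ k := by simp
      exact ⟨_, ⟨hl, t, ht, (inside_padded_iff hl (mem_cyl_ofFn y _)).2 hy⟩, mem_cyl_ofFn y _⟩
    · rintro ⟨σ, ⟨hl, t, ht, h⟩, hy⟩
      exact ⟨t, ht, (inside_padded_iff hl hy).1 h⟩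
  · intro σ hσ τ hτ hne
    refine Set.disjoint_left.2 fun y h1 h2 => hne (eq_of_mem_cyl ?_ h1 h2)
    exact (mem_certificates.1 hσ).1.trans (mem_certificates.1 hτ).1.symm
  · exact fun σ _ => measurableSet_cyl σ

theorem lt_measureReal_map_freq_iff (ν : Measure (ℕ → Bool)) [IsProbabilityMeasure ν] (C : ℕ)
    (L : List (ℕ × ℕ × ℕ)) (r : ℝ) :
    r < (ν.map (freq C)).real {x | ∃ t ∈ L, x ∈ ratBall t} ↔
      ∃ k, r < ∑ σ ∈ certificates C L k, ν.real (cyl σ) := by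
  have hm : MeasurableSet {x | ∃ t ∈ L, x ∈ ratBall t} := by
    have : {x | ∃ t ∈ L, x ∈ ratBall t} = ⋃ (t) (_ : t ∈ L), ratBall t := by ext; simp
    rw [this]
    exact (isOpen_biUnion fun t _ => isOpen_ratBall t).measurableSet
  have hU : freq C ⁻¹' {x | ∃ t ∈ L, x ∈ ratBall t} = ⋃ k, {y | ∃ t ∈ L, Inside C y t k} := by
    ext y
    simp only [Set.mem_preimage, Set.mem_ofPred_eq, freq_mem_ratBall_iff, Set.mem_iUnion]
    exact ⟨fun ⟨t, ht, k, h⟩ => ⟨k, t, ht, h⟩, fun ⟨k, t, ht, h⟩ => ⟨t, ht, k, h⟩⟩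
  have hmono : Monotone fun k => {y | ∃ t ∈ L, Inside C y t k} :=
    monotone_nat_of_le_succ fun k y ⟨t, ht, h⟩ => ⟨t, ht, h.succ⟩
  rw [map_measureReal_apply (measurable_freq C) hm, hU]
  simp_rw [← measureReal_exists_inside]
  constructor
  · intro h
    have ht : Tendsto (fun k => ν.real {y | ∃ t ∈ L, Inside C y t k}) atTop
        (𝓝 (ν.real (⋃ k, {y | ∃ t ∈ L, Inside C y t k}))) :=
      (ENNReal.tendsto_toReal (measure_ne_top _ _)).comp (tendsto_measure_iUnion_atTop hmono)
    exact (ht.eventually_const_lt h).exists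
  · rintro ⟨k, hk⟩
    exact hk.trans_le (measureReal_mono
      (Set.subset_iUnion (fun k => {y | ∃ t ∈ L, Inside C y t k}) k))

/-! ### Computable sums over finite decidable sets -/

section Sum

variable {α β : Type} [Primcodable α] [Primcodable β]

open Classical in
/-- The value of `g` at the element of `p` with code `j`, and zero if there is none. -/
noncomputable def codeTerm (p : β → Prop) (g : β → ℕ) (j : ℕ) : ℕ :=
  ((Encodable.decode (α := β) j).map fun b =>
    if Encodable.encode b = j ∧ p b then g b else 0).getD 0

/-- The sum of `g` over the elements of `p` with codes less than `e`. -/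
noncomputable def codeSum (p : β → Prop) (g : β → ℕ) (e : ℕ) : ℕ :=
  ∑ j ∈ range e, codeTerm p g j

theorem codeTerm_encode {p : β → Prop} (g : β → ℕ) {b : β} (hb : p b) :
    codeTerm p g (Encodable.encode b) = g b := by
  simp [codeTerm, Encodable.encodek, hb]

/-- The guard `Encodable.encode b = j` discards numbers that decode to `b` without being its code,
so no element is counted twice. -/
theorem exists_of_codeTerm_ne_zero {p : β → Prop} {g : β → ℕ} {j : ℕ} (h : codeTerm p g j ≠ 0) :
    ∃ b, p b ∧ Encodable.encode b = j := by
  unfold codeTerm at h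
  rcases hd : Encodable.decode (α := β) j with _ | b
  · simp [hd] at h
  · rw [hd] at h
    simp only [Option.map_some, Option.getD_some, ne_eq, ite_eq_right_iff, Classical.not_imp] at h
    exact ⟨b, h.1.2, h.1.1⟩

theorem sum_codeTerm_image {p : β → Prop} (g : β → ℕ) {F : Finset β} (hF : ∀ b, b ∈ F ↔ p b) :
    ∑ j ∈ F.image Encodable.encode, codeTerm p g j = ∑ b ∈ F, g b := by
  rw [sum_image fun a _ b _ h => Encodable.encode_injective h]
  exact sum_congr rfl fun b hb => codeTerm_encode g ((hF b).1 hb)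

theorem codeSum_le {p : β → Prop} (g : β → ℕ) {F : Finset β} (hF : ∀ b, b ∈ F ↔ p b) (e : ℕ) :
    codeSum p g e ≤ ∑ b ∈ F, g b := by
  rw [← sum_codeTerm_image g hF, codeSum]
  refine sum_le_sum_of_ne_zero fun j _ hj => ?_
  obtain ⟨b, hb, rfl⟩ := exists_of_codeTerm_ne_zero hj
  exact mem_image_of_mem _ ((hF b).2 hb)

theorem exists_le_codeSum {p : β → Prop} {F : Finset β} (hF : ∀ b, b ∈ F ↔ p b) :
    ∃ e, ∀ g : β → ℕ, ∑ b ∈ F, g b ≤ codeSum p g e := by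
  refine ⟨F.sup Encodable.encode + 1, fun g => ?_⟩
  rw [← sum_codeTerm_image g hF, codeSum]
  refine sum_le_sum_of_subset fun j hj => ?_
  obtain ⟨b, hb, rfl⟩ := mem_image.1 hj
  exact mem_range.2 (Nat.lt_succ_of_le (le_sup (f := Encodable.encode) hb))

theorem computable_codeTerm {p : α → β → Prop} (hp : ComputablePred fun q : α × β => p q.1 q.2)
    {g : α → β → ℕ} (hg : Computable₂ g) : Computable₂ fun a j => codeTerm (p a) (g a) j := by
  obtain ⟨d, hd, hpd⟩ := ComputablePred.computable_iff.1 hp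
  have h1 : PrimrecPred fun q : (α × ℕ) × β => Encodable.encode q.2 = q.1.2 :=
    Primrec.eq.comp (Primrec.encode.comp Primrec.snd) (Primrec.snd.comp Primrec.fst)
  have h2 : Computable fun q : (α × ℕ) × β => d (q.1.1, q.2) :=
    hd.comp ((Computable.fst.comp Computable.fst).pair Computable.snd)
  have h3 : Computable fun q : (α × ℕ) × β =>
      bif (decide (Encodable.encode q.2 = q.1.2) && d (q.1.1, q.2)) then g q.1.1 q.2 else 0 :=
    Computable.cond (Primrec.and.to_comp.comp h1.decide.to_comp h2)
      (hg.comp (Computable.fst.comp Computable.fst) Computable.snd) (Computable.const 0)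
  have h4 : Computable fun q : α × ℕ => ((Encodable.decode (α := β) q.2).map fun b =>
      bif (decide (Encodable.encode b = q.2) && d (q.1, b)) then g q.1 b else 0).getD 0 :=
    Computable.option_getD (Computable.option_map (Computable.decode.comp Computable.snd) h3.to₂)
      (Computable.const 0)
  refine h4.of_eq fun q => ?_
  have h5 : ∀ b, p q.1 b ↔ d (q.1, b) = true := fun b => iff_of_eq (congrFun hpd (q.1, b))
  simp only [codeTerm, h5, Bool.cond_eq_ite, Bool.and_eq_true,
    decide_eq_true_eq]

theorem computable_codeSum {p : α → β → Prop} (hp : ComputablePred fun q : α × β => p q.1 q.2)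
    {g : α → β → ℕ} (hg : Computable₂ g) : Computable₂ fun a e => codeSum (p a) (g a) e := by
  have h : Computable₂ fun (q : α × ℕ) (r : ℕ × ℕ) => r.2 + codeTerm (p q.1) (g q.1) r.1 :=
    Primrec.nat_add.to_comp.comp (Computable.snd.comp Computable.snd)
      ((computable_codeTerm hp hg).comp (Computable.fst.comp Computable.fst)
        (Computable.fst.comp Computable.snd))
  refine (Computable.nat_rec (f := fun q : α × ℕ => q.2) (g := fun _ => 0)
    Computable.snd (Computable.const 0) h).of_eq fun q => ?_
  obtain ⟨a, e⟩ := q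
  induction e with
  | zero => rfl
  | succ e ih =>
    simp only [codeSum, sum_range_succ] at ih ⊢
    rw [ih]

end Sum

theorem isComputableInterval_map_freq {ν : Measure (ℕ → Bool)} [IsProbabilityMeasure ν]
    (hν : IsComputableCantor ν) (C : ℕ) : IsComputableInterval (ν.map (freq C)) := by
  obtain ⟨f, hf, hfν⟩ := hν
  -- In units of `2⁻ⁿ` the value `f σ n` errs by at most 1, so `f σ n - 1` is a lower bound;
  -- truncation at 0 is harmless because measures are nonnegative. The loss is at most 2 per
  -- cylinder.
  have hlow : ∀ σ n, ((f σ n - 1 : ℕ) : ℝ) ≤ 2 ^ n * ν.real (cyl σ) := by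
    intro σ n
    have h2 : (0 : ℝ) < 2 ^ n := by positivity
    rcases Nat.eq_zero_or_pos (f σ n) with h | h
    · rw [h]; simp only [zero_tsub, Nat.cast_zero]; positivity
    · have h1 := (abs_le.1 (hfν σ n)).1
      rw [inv_pow, ← one_div, neg_le_sub_iff_le_add, ← sub_le_iff_le_add, ← sub_div,
        div_le_iff₀ h2] at h1
      rw [Nat.cast_pred h, mul_comm]
      linarith
  have hup : ∀ σ n, 2 ^ n * ν.real (cyl σ) - 2 ≤ ((f σ n - 1 : ℕ) : ℝ) := by
    intro σ n
    have h2 : (0 : ℝ) < 2 ^ n := by positivity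
    have h1 := (abs_le.1 (hfν σ n)).2
    rw [inv_pow, ← one_div, sub_le_iff_le_add, ← add_div, le_div_iff₀ h2] at h1
    have h3 : (f σ n : ℝ) ≤ (f σ n - 1 : ℕ) + 1 := mod_cast Nat.le_add_of_sub_le le_rfl
    linarith
  -- The search runs over the stage `k`, the precision `n` and the bound `e` on codes of strings.
  let S : (List (ℕ × ℕ × ℕ) × ℕ × ℕ) × (ℕ × ℕ × ℕ) → Prop := fun q =>
    q.1.2.1 * 2 ^ q.2.2.1 < (q.1.2.2 + 1) *
      codeSum (Certifies C q.1.1 q.2.1) (fun σ => f σ q.2.2.1 - 1) q.2.2.2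
  have hS : REPred S := by
    have hp : ComputablePred fun q : ((List (ℕ × ℕ × ℕ) × ℕ × ℕ) × (ℕ × ℕ × ℕ)) × List Bool =>
        Certifies C q.1.1.1 q.1.2.1 q.2 :=
      ((primrecPred_certifies C).comp
        (((Primrec.fst.comp (Primrec.fst.comp Primrec.fst)).pair
          (Primrec.fst.comp (Primrec.snd.comp Primrec.fst))).pair Primrec.snd)).computablePred
    have hg : Computable₂ fun (q : (List (ℕ × ℕ × ℕ) × ℕ × ℕ) × (ℕ × ℕ × ℕ)) (σ : List Bool) =>
        f σ q.2.2.1 - 1 :=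
      Primrec.nat_sub.to_comp.comp (hf.comp Computable.snd
        (Computable.fst.comp (Computable.snd.comp (Computable.snd.comp Computable.fst))))
        (Computable.const 1)
    have hc := (computable_codeSum (p := fun q => Certifies C q.1.1 q.2.1) hp hg).comp
      Computable.id (Computable.snd.comp (Computable.snd.comp Computable.snd))
    have hl : Computable fun q : (List (ℕ × ℕ × ℕ) × ℕ × ℕ) × (ℕ × ℕ × ℕ) =>
        q.1.2.1 * 2 ^ q.2.2.1 :=
      (Primrec.nat_mul.comp (Primrec.fst.comp (Primrec.snd.comp Primrec.fst))
        ((primrec_nat_pow 2).comp (Primrec.fst.comp (Primrec.snd.comp Primrec.snd)))).to_comp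
    have hr := Primrec.nat_mul.to_comp.comp
      (Primrec.succ.comp (Primrec.snd.comp (Primrec.snd.comp Primrec.fst))).to_comp hc
    exact ComputablePred.to_re (Computable.computablePred
      (Primrec.nat_lt.decide.to_comp.comp hl hr))
  refine (rePred_exists hS).of_eq fun a => ?_
  obtain ⟨L, m, d⟩ := a
  rw [lt_measureReal_map_freq_iff]
  have hd : (0 : ℝ) < d + 1 := by positivity
  constructor
  · rintro ⟨⟨k, n, e⟩, h⟩
    refine ⟨k, ?_⟩
    have h2 : (0 : ℝ) < 2 ^ n := by positivity
    have h1 := codeSum_le (fun σ => f σ n - 1)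
      (fun σ => mem_certificates (C := C) (L := L) (k := k) (σ := σ)) e
    have h3 : ((codeSum (Certifies C L k) (fun σ => f σ n - 1) e : ℕ) : ℝ) ≤
        2 ^ n * ∑ σ ∈ certificates C L k, ν.real (cyl σ) := by
      rw [mul_sum]
      refine (Nat.cast_le.2 h1).trans ?_
      rw [Nat.cast_sum]
      exact sum_le_sum fun σ _ => hlow σ n
    have h4 : (m : ℝ) * 2 ^ n <
        (d + 1) * (codeSum (Certifies C L k) (fun σ => f σ n - 1) e : ℕ) := mod_cast h
    rw [div_lt_iff₀ hd]
    have h5 := h4.trans_le (mul_le_mul_of_nonneg_left h3 hd.le)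
    refine lt_of_mul_lt_mul_right (a := (2 : ℝ) ^ n) ?_ h2.le
    linarith
  · rintro ⟨k, hk⟩
    set s := ∑ σ ∈ certificates C L k, ν.real (cyl σ) with hs
    obtain ⟨e, he⟩ := exists_le_codeSum
      (fun σ => mem_certificates (C := C) (L := L) (k := k) (σ := σ))
    dsimp only at hk
    rw [div_lt_iff₀ hd] at hk
    -- The precision makes the gap `2 ^ n * (s * (d + 1) - m)` exceed the total rounding loss of 2
    -- per certificate, scaled by `d + 1`.
    obtain ⟨n, hn⟩ := pow_unbounded_of_one_lt
      ((d + 1) * (2 * (certificates C L k).card) / (s * (d + 1) - m) : ℝ) one_lt_two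
    rw [div_lt_iff₀ (sub_pos.2 hk)] at hn
    refine ⟨(k, n, e), ?_⟩
    have h3 : 2 ^ n * s - 2 * (certificates C L k).card ≤
        ((codeSum (Certifies C L k) (fun σ => f σ n - 1) e : ℕ) : ℝ) := by
      refine le_trans ?_ (Nat.cast_le.2 (he fun σ => f σ n - 1))
      rw [Nat.cast_sum, hs, mul_sum]
      refine le_trans (le_of_eq ?_) (sum_le_sum fun σ _ => hup σ n)
      rw [sum_sub_distrib, sum_const, nsmul_eq_mul]
      ring
    have h4 := mul_le_mul_of_nonneg_left h3 hd.le
    change m * 2 ^ n < (d + 1) * codeSum (Certifies C L k) (fun σ => f σ n - 1) e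
    rw [← @Nat.cast_lt ℝ]
    push_cast
    refine lt_of_lt_of_le ?_ h4
    linarith

end BernoulliRandom

/-- If a proper binary sequence `x` is Bernoulli `p`-random for some `p ∈ [0,1]`, then `p` is
proper. -/
theorem theorem3p5 (x : ℕ → Bool) (hx : BernoulliRandom.ProperSeq x)
    (p : unitInterval) (hp : BernoulliRandom.IsBernoulliRandom p x) :
    BernoulliRandom.ProperReal p := by
  obtain ⟨ν, hν, hνc, hxν⟩ := hx
  obtain ⟨C, rfl⟩ := BernoulliRandom.exists_freq_eq hp
  exact ⟨ν.map (BernoulliRandom.freq C),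
    Measure.isProbabilityMeasure_map (BernoulliRandom.measurable_freq C).aemeasurable,
    BernoulliRandom.isComputableInterval_map_freq hνc C,
    BernoulliRandom.isMLRandom_map_freq hxν C⟩
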